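/- Let $(\Omega,\Sigma,\mathbb P_0)$ be a probability space, write $\mathcal L^2=\mathcal L^2(\Omega,\Sigma,\mathbb P_0)$, and let $n\ge 2$ be an integer. For $X\in\mathcal L^2$ let $\mathrm{MAXVAR}_n(X)=\mathbb E(\max\{X_1,\dots,X_n\})$, where $X_1,\dots,X_n$ are i.i.d. copies of $X$, and let $w_n(\alpha)=n(n-1)(1-\alpha)\alpha^{n-2}$ for $\alpha\in[0,1]$ (with $0^0=1$). A risk envelope of $\mathrm{MAXVAR}_n$ is a nonempty, convex and closed set $\mathcal Q\subseteq\mathcal L^2$ such that $$\mathrm{MAXVAR}_n(X)=\sup_{Q\in\mathcal Q}\mathbb E(XQ)\qquad\text{for all }X\in\mathcal L^2.$$ Then $\mathrm{MAXVAR}_n$ has exactly one risk envelope, namely $$\mathcal Q_n=\mathrm{cl}\left\{\int_0^1Q_\alpha\, w_n(\alpha)\,d\alpha \;:\; 0\le Q_\alpha\le\frac1{1-\alpha},\ \mathbb E(Q_\alpha)=1\ \ \forall\alpha\in[0,1)\right\},$$ where $(Q_\alpha)_{\alpha\in[0,1)}$ ranges over the families of random variables for which $(\alpha,\omega)\mapsto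 Q_\alpha(\omega)$ is jointly measurable, the integral over $\alpha$ is taken pointwise in $\omega\in\Omega$, and $\mathrm{cl}$ is the closure in $\mathcal L^2$. -/

import Mathlib

open MeasureTheory ProbabilityTheory Set

noncomputable section

/-- `MAXVAR_n(X) = E(max {X_1, …, X_n})` for i.i.d. copies `X_1, …, X_n` of `X`, realised as the
coordinates `ω ↦ X (ω i)` on the product probability space `Ω ^ n`. -/
def maxvar {Ω : Type*} [MeasurableSpace Ω] (P : Measure Ω) (n : ℕ) (X : Ω → ℝ) : ℝ :=
  ∫ ω : Fin n → Ω, (⨆ i, X (ω i)) ∂(Measure.pi fun _ => P)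

/-- The maximum of the copies of an integrable random variable is integrable, so that the
expectation defining `maxvar` is a genuine one. -/
theorem integrable_iSup_copies {Ω : Type*} [MeasurableSpace Ω] (P : Measure Ω)
    [IsProbabilityMeasure P] (n : ℕ) (hn : 1 ≤ n) {X : Ω → ℝ} (hX : Integrable X P) :
    Integrable (fun ω : Fin n → Ω => ⨆ i, X (ω i)) (Measure.pi fun _ => P) := by
  have : Nonempty (Fin n) := ⟨⟨0, hn⟩⟩
  have hcopy : ∀ i : Fin n,
      Integrable (fun ω : Fin n → Ω => X (ω i)) (Measure.pi fun _ => P) := fun i =>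
    (measurePreserving_eval (fun _ : Fin n => P) i).integrable_comp_of_integrable hX
  refine Integrable.mono' (integrable_finsetSum Finset.univ fun i _ => (hcopy i).norm) ?_ ?_
  · exact (AEMeasurable.iSup fun i => (hcopy i).aestronglyMeasurable.aemeasurable).aestronglyMeasurable
  · refine Filter.Eventually.of_forall fun ω => ?_
    obtain ⟨j, hj⟩ := exists_eq_ciSup_of_finite (f := fun i => X (ω i))
    rw [← hj]
    exact Finset.single_le_sum (f := fun i => ‖X (ω i)‖) (fun i _ => norm_nonneg _)
      (Finset.mem_univ j)

/-- The value of `maxvar` does not depend on the choice of the i.i.d. copies. -/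
theorem integral_iSup_eq_maxvar {Ω Ω' : Type*} [MeasurableSpace Ω] [MeasurableSpace Ω']
    (P : Measure Ω) [IsProbabilityMeasure P] (P' : Measure Ω') [IsProbabilityMeasure P']
    (n : ℕ) {X : Ω → ℝ} (hX : AEMeasurable X P) (Y : Fin n → Ω' → ℝ)
    (hind : iIndepFun Y P') (hid : ∀ i, IdentDistrib (Y i) X P' P) :
    ∫ ω, (⨆ i, Y i ω) ∂P' = maxvar P n X := by
  have hcopy : ∀ i : Fin n, AEMeasurable (fun ω : Fin n → Ω => X (ω i))
      (Measure.pi fun _ => P) := fun i =>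
    hX.comp_quasiMeasurePreserving
      (measurePreserving_eval (fun _ : Fin n => P) i).quasiMeasurePreserving
  have h1 := (iIndepFun_iff_map_fun_eq_pi_map fun i => (hid i).aemeasurable_fst).1 hind
  have h2 := (iIndepFun_iff_map_fun_eq_pi_map hcopy).1
    (iIndepFun_pi (μ := fun _ : Fin n => P) (X := fun _ => X) fun _ => hX)
  have h3 : ∀ i : Fin n, (Measure.pi fun _ : Fin n => P).map (fun ω => X (ω i)) = P.map X := by
    intro i
    have hmp := measurePreserving_eval (fun _ : Fin n => P) i
    have := AEMeasurable.map_map_of_aemeasurable (μ := Measure.pi fun _ : Fin n => P)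
      (g := X) (f := Function.eval i) (by rw [hmp.map_eq]; exact hX) hmp.measurable.aemeasurable
    rw [hmp.map_eq] at this
    exact this.symm
  have hm : Measurable fun x : Fin n → ℝ => ⨆ i, x i :=
    Measurable.iSup fun i => measurable_pi_apply i
  have e1 := integral_map (aemeasurable_pi_lambda _ fun i => (hid i).aemeasurable_fst)
    (μ := P') hm.aestronglyMeasurable
  have e2 := integral_map (aemeasurable_pi_lambda _ hcopy)
    (μ := Measure.pi fun _ : Fin n => P) hm.aestronglyMeasurable
  rw [maxvar, ← e2, ← e1, h1, h2]
  congr 2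
  funext i
  rw [h3, (hid i).map_eq]

/-- The weight `w_n(α) = n (n - 1) (1 - α) α ^ (n - 2)`, for `n ≥ 2` (with `0 ^ 0 = 1`). -/
def maxvarWeight (n : ℕ) (α : ℝ) : ℝ :=
  (n : ℝ) * ((n : ℝ) - 1) * (1 - α) * α ^ (n - 2)

/-- The elements of `L²` given by the pointwise integrals `∫_0^1 Q_α w_n(α) dα`, over the jointly
measurable families `(Q_α)` with `0 ≤ Q_α ≤ 1 / (1 - α)` and `E(Q_α) = 1` for all `α ∈ [0, 1)`.
The values of the family at indices `α` outside `[0, 1)` are irrelevant. -/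
def maxvarMixtures {Ω : Type*} [MeasurableSpace Ω] (P : Measure Ω) (n : ℕ) : Set (Lp ℝ 2 P) :=
  {Y | ∃ Q : ℝ → Ω → ℝ, Measurable (Function.uncurry Q) ∧
      (∀ α ∈ Ico (0 : ℝ) 1, (∀ ω, 0 ≤ Q α ω ∧ Q α ω ≤ 1 / (1 - α)) ∧ ∫ ω, Q α ω ∂P = 1) ∧
      ∀ᵐ ω ∂P, Y ω = ∫ α in (0 : ℝ)..1, Q α ω * maxvarWeight n α}

/-- `𝒬` is a risk envelope of the functional `R` on `L²`: a nonempty, convex and closed set with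
`R(X) = sup {E(X Q) : Q ∈ 𝒬}` for all `X` in `L²`. -/
structure IsRiskEnvelope {Ω : Type*} [MeasurableSpace Ω] (P : Measure Ω)
    (R : Lp ℝ 2 P → ℝ) (𝒬 : Set (Lp ℝ 2 P)) : Prop where
  nonempty : 𝒬.Nonempty
  convex : Convex ℝ 𝒬
  isClosed : IsClosed 𝒬
  isLUB : ∀ X : Lp ℝ 2 P, IsLUB ((fun Q : Lp ℝ 2 P => ∫ ω, X ω * Q ω ∂P) '' 𝒬) (R X)

end

/-!
Let `q` be the quantile function of `X`. Two ingredients describe `MAXVAR_n` through `q`.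

* `MAXVAR_n(X) = ∫₀¹ n s^(n-1) q(s) ds`, because the largest of `n` copies of `X` and `q` evaluated
  at the largest of `n` independent uniform variables have the same distribution function
  (`map_iSup_copies`). Since `n s^(n-1) = ∫₀ˢ n (n-1) α^(n-2) dα`, Fubini's theorem rewrites this as
  `∫₀¹ n (n-1) α^(n-2) (∫_α^1 q) dα` (`maxvar_eq_integral_tail`).
* For a density `0 ≤ Q ≤ 1/(1-α)` with `E(Q) = 1` one has `(1-α) E(X Q) ≤ ∫_α^1 q`, by comparing
  `(1-α) (X - q(α)) Q` with `(X - q(α))⁺` (`mul_integral_mul_le_integral_quantile_tail`). Equality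
  holds for the density `tailDensity`, which is `1/(1-α)` above `q(α)` and spreads the missing mass
  over the atom at `q(α)` (`mul_integral_mul_tailDensity`); it is jointly measurable in `α` and `ω`.

Integrating over `α` against `w_n(α) = n (n-1) (1-α) α^(n-2)`, and exchanging this integral with the
expectation, shows that `E(X Y) ≤ MAXVAR_n(X)` for every mixture `Y`, with equality for the mixture
of the tail densities. The mixtures form a convex set, and passing to the closure does not change
the supremum, so the closure is a risk envelope. Uniqueness (`IsRiskEnvelope.unique`) holds for any
functional: by the Hahn–Banach and Riesz theorems a closed convex set in `L²` is determined by its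
support function.
-/

/-! ### Quantile functions and the law of the maximum -/

/-- The uniform distribution on the open unit interval. -/
noncomputable abbrev uniform01 : Measure ℝ := volume.restrict (Ioo (0 : ℝ) 1)

instance : IsProbabilityMeasure uniform01 := ⟨by simp⟩

/-- The lower quantile function `α ↦ inf {x | α ≤ μ (-∞, x]}` of a probability measure on `ℝ`.
It is set to `0` outside `(0, 1)`, where the infimum may be over an empty or unbounded set. -/
noncomputable def quantile (μ : Measure ℝ) : ℝ → ℝ :=
  (Ioo (0 : ℝ) 1).indicator fun α => sInf {x | α ≤ cdf μ x}

/-- The Galois connection between the quantile function and the distribution function. -/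
theorem quantile_le_iff (μ : Measure ℝ) {α : ℝ} (hα : α ∈ Ioo (0 : ℝ) 1) (x : ℝ) :
    quantile μ α ≤ x ↔ α ≤ cdf μ x := by
  have hne : {x | α ≤ cdf μ x}.Nonempty :=
    (((tendsto_cdf_atTop μ).eventually (lt_mem_nhds hα.2)).exists).imp fun _ h => le_of_lt h
  have hbdd : BddBelow {x | α ≤ cdf μ x} := by
    obtain ⟨a, ha⟩ := ((tendsto_cdf_atBot μ).eventually (gt_mem_nhds hα.1)).exists
    refine ⟨a, fun x hx => ?_⟩
    by_contra! h
    exact absurd (hx.trans (monotone_cdf μ h.le)) (not_le.2 ha)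
  rw [quantile, indicator_of_mem hα]
  constructor
  · intro h
    -- The distribution function is right continuous, so the infimum is attained.
    refine ge_of_tendsto (((cdf μ).right_continuous x).tendsto.mono_left
      (nhdsWithin_mono x Ioi_subset_Ici_self)) ?_
    filter_upwards [self_mem_nhdsWithin] with y hy
    obtain ⟨z, hz, hzy⟩ := (csInf_lt_iff hbdd hne).1 (lt_of_le_of_lt h hy)
    exact le_trans hz (monotone_cdf μ hzy.le)
  · exact fun h => csInf_le hbdd h

theorem quantile_monotoneOn (μ : Measure ℝ) : MonotoneOn (quantile μ) (Ioo (0 : ℝ) 1) :=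
  fun _ ha _ hb hab => (quantile_le_iff μ ha _).2 (hab.trans ((quantile_le_iff μ hb _).1 le_rfl))

theorem inter_quantile_preimage_Iic (μ : Measure ℝ) (x : ℝ) :
    quantile μ ⁻¹' Iic x ∩ Ioo 0 1 = Iic (cdf μ x) ∩ Ioo (0 : ℝ) 1 := by
  ext α
  simp only [mem_inter_iff, mem_preimage, mem_Iic, and_congr_left_iff]
  exact fun h => quantile_le_iff μ h x

theorem measurable_quantile (μ : Measure ℝ) : Measurable (quantile μ) := by
  refine measurable_of_Iic fun x => ?_
  rw [← inter_union_compl (quantile μ ⁻¹' Iic x) (Ioo (0 : ℝ) 1), inter_quantile_preimage_Iic]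
  refine (measurableSet_Iic.inter measurableSet_Ioo).union ?_
  have : quantile μ ⁻¹' Iic x ∩ (Ioo (0 : ℝ) 1)ᶜ = {α | (0 : ℝ) ≤ x} ∩ (Ioo (0 : ℝ) 1)ᶜ := by
    ext α
    simp only [mem_inter_iff, mem_preimage, mem_Iic, and_congr_left_iff]
    intro h
    simp [quantile, indicator_of_notMem h]
  rw [this]
  exact (MeasurableSet.const _).inter measurableSet_Ioo.compl

/-- The distribution on `(0, 1)` of the largest of `n` independent uniform variables. -/
noncomputable def maxUniform (n : ℕ) : Measure ℝ :=
  uniform01.withDensity fun s => ENNReal.ofReal (n * s ^ (n - 1))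

theorem maxUniform_Iic {n : ℕ} (hn : 1 ≤ n) {t : ℝ} (h0 : 0 ≤ t) (h1 : t ≤ 1) :
    maxUniform n (Iic t ∩ Ioo 0 1) = ENNReal.ofReal (t ^ n) := by
  have hm : MeasurableSet (Iic t ∩ Ioo (0 : ℝ) 1) := measurableSet_Iic.inter measurableSet_Ioo
  have hae : (Iic t ∩ Ioo (0 : ℝ) 1 : Set ℝ) =ᵐ[volume] Ioc 0 t := by
    have h : ∀ᵐ s : ℝ, s ≠ 1 := by simp [ae_iff]
    filter_upwards [h] with s hs
    refine propext ⟨fun h => ⟨h.2.1, h.1⟩, fun h => ⟨h.2, h.1, lt_of_le_of_ne (h.2.trans h1) hs⟩⟩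
  rw [maxUniform, withDensity_apply _ hm, Measure.restrict_restrict hm, inter_assoc, inter_self,
    Measure.restrict_congr_set hae, ← ofReal_integral_eq_lintegral_ofReal,
    ← intervalIntegral.integral_of_le h0]
  · congr 1
    have hn' : ((n : ℝ)) ≠ 0 := by positivity
    simp only [intervalIntegral.integral_const_mul, integral_pow]
    rw [Nat.sub_add_cancel hn, zero_pow (by omega), Nat.cast_sub hn]
    simp [mul_div_cancel₀, hn']
  · exact (Continuous.integrableOn_Icc (by fun_prop)).mono_set Ioc_subset_Icc_self
  · refine (ae_restrict_iff' measurableSet_Ioc).2 (Filter.Eventually.of_forall fun s hs => ?_)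
    have := hs.1.le
    positivity

theorem map_quantile_maxUniform_Iic (μ : Measure ℝ) {n : ℕ} (hn : 1 ≤ n) (x : ℝ) :
    (maxUniform n).map (quantile μ) (Iic x) = ENNReal.ofReal (cdf μ x ^ n) := by
  have hq := measurable_quantile μ
  have hae : ∀ᵐ s ∂maxUniform n, s ∈ Ioo (0 : ℝ) 1 :=
    (withDensity_absolutelyContinuous _ _).ae_le (ae_restrict_mem measurableSet_Ioo)
  rw [Measure.map_apply hq measurableSet_Iic, ← Measure.measure_inter_eq_of_ae hae,
    inter_comm, inter_quantile_preimage_Iic,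
    maxUniform_Iic hn (cdf_nonneg μ x) (cdf_le_one μ x)]

theorem maxUniform_one : maxUniform 1 = uniform01 := by
  simp [maxUniform]

/-- A probability measure is the law of its quantile function at a uniform variable. -/
theorem map_quantile_uniform01 (μ : Measure ℝ) [IsProbabilityMeasure μ] :
    uniform01.map (quantile μ) = μ := by
  have : IsProbabilityMeasure (uniform01.map (quantile μ)) :=
    Measure.isProbabilityMeasure_map (measurable_quantile μ).aemeasurable
  refine Measure.ext_of_Iic _ _ fun x => ?_
  rw [← maxUniform_one, map_quantile_maxUniform_Iic μ le_rfl, pow_one, ofReal_cdf]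

section SampleSpace

variable {Ω : Type*} [MeasurableSpace Ω]

theorem measurable_iSup_copies (n : ℕ) {X : Ω → ℝ} (hX : Measurable X) :
    Measurable fun ω : Fin n → Ω => ⨆ i, X (ω i) :=
  Measurable.iSup fun i => hX.comp (measurable_pi_apply i)

/-- The largest of `n` independent copies of `X` is distributed as the quantile function of `X` at
the largest of `n` independent uniform variables. -/
theorem map_iSup_copies (P : Measure Ω) [IsProbabilityMeasure P] {n : ℕ} (hn : 1 ≤ n)
    {X : Ω → ℝ} (hX : Measurable X) :
    (Measure.pi fun _ : Fin n => P).map (fun ω => ⨆ i, X (ω i)) =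
      (maxUniform n).map (quantile (P.map X)) := by
  have : Nonempty (Fin n) := ⟨⟨0, hn⟩⟩
  have := Measure.isProbabilityMeasure_map (μ := P) hX.aemeasurable
  have hm := measurable_iSup_copies n hX
  have := Measure.isProbabilityMeasure_map (μ := Measure.pi fun _ : Fin n => P) hm.aemeasurable
  refine Measure.ext_of_Iic _ _ fun x => ?_
  have hset : (fun ω : Fin n → Ω => ⨆ i, X (ω i)) ⁻¹' Iic x = univ.pi fun _ => X ⁻¹' Iic x := by
    ext ω
    simp [ciSup_le_iff (finite_range _).bddAbove]
  rw [map_quantile_maxUniform_Iic _ hn, Measure.map_apply hm measurableSet_Iic, hset,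
    Measure.pi_pi, Finset.prod_const, Finset.card_univ, Fintype.card_fin,
    ← Measure.map_apply hX measurableSet_Iic, ← ofReal_cdf, ENNReal.ofReal_pow (cdf_nonneg _ x)]

theorem maxvar_eq_integral_quantile (P : Measure Ω) [IsProbabilityMeasure P] {n : ℕ} (hn : 1 ≤ n)
    {X : Ω → ℝ} (hX : Measurable X) :
    maxvar P n X = ∫ s in Ioo (0 : ℝ) 1, n * s ^ (n - 1) * quantile (P.map X) s := by
  have hm := measurable_iSup_copies n hX
  have h1 := integral_map (μ := Measure.pi fun _ : Fin n => P) hm.aemeasurable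
    (f := id) aestronglyMeasurable_id
  rw [map_iSup_copies P hn hX, integral_map (measurable_quantile _).aemeasurable
    aestronglyMeasurable_id, maxUniform, integral_withDensity_eq_integral_toReal_smul
    (by fun_prop) (.of_forall fun _ => ENNReal.ofReal_lt_top)] at h1
  rw [maxvar]
  refine Eq.trans h1.symm (setIntegral_congr_fun measurableSet_Ioo fun s hs => ?_)
  have h0 : 0 ≤ (n : ℝ) * s ^ (n - 1) := by have := hs.1.le; positivity
  simp only [ENNReal.toReal_ofReal h0, smul_eq_mul, id]

section Law

variable (P : Measure Ω) [IsProbabilityMeasure P] {X : Ω → ℝ}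

theorem integral_comp_eq_integral_comp_quantile (hX : Measurable X) {g : ℝ → ℝ}
    (hg : Measurable g) :
    ∫ ω, g (X ω) ∂P = ∫ s in Ioo (0 : ℝ) 1, g (quantile (P.map X) s) := by
  have := Measure.isProbabilityMeasure_map (μ := P) hX.aemeasurable
  rw [← integral_map hX.aemeasurable hg.aestronglyMeasurable]
  conv_lhs => rw [← map_quantile_uniform01 (P.map X)]
  exact integral_map (measurable_quantile _).aemeasurable hg.aestronglyMeasurable

theorem integrableOn_quantile (hX : Measurable X) (hi : Integrable X P) :
    IntegrableOn (quantile (P.map X)) (Ioo 0 1) := by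
  have := Measure.isProbabilityMeasure_map (μ := P) hX.aemeasurable
  have h1 : Integrable id (P.map X) :=
    (integrable_map_measure aestronglyMeasurable_id hX.aemeasurable).2 hi
  rw [← map_quantile_uniform01 (P.map X)] at h1
  exact (integrable_map_measure aestronglyMeasurable_id
    (measurable_quantile _).aemeasurable).1 h1

/-- The tail integral of the quantile function, as in the Rockafellar–Uryasev formula for the
conditional value at risk. -/
theorem integral_quantile_tail (hX : Measurable X) (hi : Integrable X P) {α : ℝ}
    (hα : α ∈ Ioo (0 : ℝ) 1) :
    ∫ s in Ioo α 1, quantile (P.map X) s =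
      (1 - α) * quantile (P.map X) α + ∫ ω, max (X ω - quantile (P.map X) α) 0 ∂P := by
  set q := quantile (P.map X)
  have hsub : Ioo α 1 ⊆ Ioo (0 : ℝ) 1 := Ioo_subset_Ioo_left hα.1.le
  have hq : IntegrableOn q (Ioo α 1) := (integrableOn_quantile P hX hi).mono_set hsub
  have h : ∫ ω, max (X ω - q α) 0 ∂P = ∫ s in Ioo α 1, (q s - q α) := by
    rw [integral_comp_eq_integral_comp_quantile P hX (g := fun x => max (x - q α) 0)
      (by fun_prop)]
    have h2 : ∫ s in Ioo (0 : ℝ) 1, max (q s - q α) 0 = ∫ s in Ioo α 1, max (q s - q α) 0 := by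
      refine setIntegral_eq_of_subset_of_forall_sdiff_eq_zero measurableSet_Ioo hsub
        fun s hs => max_eq_right ?_
      have : s ≤ α := by
        by_contra! h
        exact hs.2 ⟨h, hs.1.2⟩
      exact sub_nonpos.2 (quantile_monotoneOn _ hs.1 hα this)
    refine h2.trans (setIntegral_congr_fun measurableSet_Ioo fun s hs => max_eq_left ?_)
    exact sub_nonneg.2 (quantile_monotoneOn _ hα (hsub hs) hs.1.le)
  rw [h, integral_sub hq (by simp), setIntegral_const]
  simp [measureReal_def, hα.2.le]

/-- Duality bound for the conditional value at risk. -/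
theorem mul_integral_mul_le_integral_quantile_tail (hX : Measurable X) (hi : Integrable X P)
    {α : ℝ} (hα : α ∈ Ioo (0 : ℝ) 1) {Q : Ω → ℝ} (hQ : Measurable Q)
    (hb : ∀ ω, 0 ≤ Q ω ∧ Q ω ≤ 1 / (1 - α)) (h1 : ∫ ω, Q ω ∂P = 1) :
    (1 - α) * ∫ ω, X ω * Q ω ∂P ≤ ∫ s in Ioo α 1, quantile (P.map X) s := by
  have hα' : 0 < 1 - α := sub_pos.2 hα.2
  rw [integral_quantile_tail P hX hi hα]
  set c := quantile (P.map X) α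
  have hbQ : ∀ᵐ ω ∂P, ‖Q ω‖ ≤ 1 / (1 - α) :=
    .of_forall fun ω => by rw [Real.norm_of_nonneg (hb ω).1]; exact (hb ω).2
  have hQi : Integrable Q P := Integrable.of_bound hQ.aestronglyMeasurable _ hbQ
  have hXQ : Integrable (fun ω => X ω * Q ω) P := hi.mul_bdd hQ.aestronglyMeasurable hbQ
  have hpos : Integrable (fun ω => max (X ω - c) 0) P := (hi.sub (integrable_const c)).pos_part
  have key : ∫ ω, ((1 - α) * (X ω * Q ω) - (1 - α) * c * Q ω) ∂P ≤ ∫ ω, max (X ω - c) 0 ∂P := by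
    refine integral_mono ((hXQ.const_mul _).sub (hQi.const_mul _)) hpos fun ω => ?_
    obtain ⟨h0, h2⟩ := hb ω
    rw [le_div_iff₀ hα'] at h2
    have h3 : (X ω - c) * (Q ω * (1 - α)) ≤ max (X ω - c) 0 * (Q ω * (1 - α)) :=
      mul_le_mul_of_nonneg_right (le_max_left _ _) (by positivity)
    have h4 : max (X ω - c) 0 * (Q ω * (1 - α)) ≤ max (X ω - c) 0 :=
      mul_le_of_le_one_right (le_max_right _ _) h2
    calc _ = (X ω - c) * (Q ω * (1 - α)) := by ring
      _ ≤ _ := h3.trans h4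
  rw [integral_sub (hXQ.const_mul _) (hQi.const_mul _), integral_const_mul, integral_const_mul,
    h1] at key
  linarith

end Law

/-! ### Optimal densities for the conditional value at risk -/

section Law

variable (P : Measure Ω) [IsProbabilityMeasure P] {X : Ω → ℝ}

/-- The part of `(0, 1)` on which the quantile function is below its value at `α` lies in `(0, α)`. -/
theorem measureReal_Iio_quantile_le (μ : Measure ℝ) [IsProbabilityMeasure μ] {α : ℝ}
    (hα : α ∈ Ioo (0 : ℝ) 1) : μ.real (Iio (quantile μ α)) ≤ α := by
  have hsub : quantile μ ⁻¹' Iio (quantile μ α) ∩ Ioo 0 1 ⊆ Ioo 0 α := by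
    intro s hs
    refine ⟨hs.2.1, ?_⟩
    by_contra! h
    exact absurd (quantile_monotoneOn μ hα hs.2 h) (not_le.2 hs.1)
  have h : μ (Iio (quantile μ α)) ≤ ENNReal.ofReal α := by
    rw [← congrArg (fun ν : Measure ℝ => ν (Iio (quantile μ α))) (map_quantile_uniform01 μ),
      Measure.map_apply (measurable_quantile μ) measurableSet_Iio, Measure.restrict_apply
      (measurable_quantile μ measurableSet_Iio)]
    simpa using measure_mono (μ := volume) hsub
  exact ENNReal.toReal_le_of_le_ofReal hα.1.le h

/-- The fraction of the atom of `μ` at its `α`-quantile `c` that is needed to complete `(c, ∞)` to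
probability `1 - α`. If `c` is not an atom, it is `0` by division by zero. -/
noncomputable def atomWeight (μ : Measure ℝ) (α : ℝ) : ℝ :=
  (1 - α - μ.real (Ioi (quantile μ α))) / μ.real {quantile μ α}

theorem measureReal_Ioi_quantile_le (μ : Measure ℝ) [IsProbabilityMeasure μ] {α : ℝ}
    (hα : α ∈ Ioo (0 : ℝ) 1) : μ.real (Ioi (quantile μ α)) ≤ 1 - α := by
  have h := (quantile_le_iff μ hα _).1 le_rfl
  rw [cdf_eq_real] at h
  rw [← compl_Iic, probReal_compl_eq_one_sub measurableSet_Iic]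
  linarith

theorem le_measureReal_Ioi_add_atom (μ : Measure ℝ) [IsProbabilityMeasure μ] {α : ℝ}
    (hα : α ∈ Ioo (0 : ℝ) 1) :
    1 - α ≤ μ.real (Ioi (quantile μ α)) + μ.real {quantile μ α} := by
  have h := measureReal_Iio_quantile_le μ hα
  have h2 := probReal_compl_eq_one_sub (μ := μ) (measurableSet_Iio (a := quantile μ α))
  rw [compl_Iio, ← Ioi_union_left, measureReal_union (by simp) (measurableSet_singleton _)] at h2
  linarith

theorem atomWeight_nonneg (μ : Measure ℝ) [IsProbabilityMeasure μ] {α : ℝ}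
    (hα : α ∈ Ioo (0 : ℝ) 1) : 0 ≤ atomWeight μ α :=
  div_nonneg (sub_nonneg.2 (measureReal_Ioi_quantile_le μ hα)) measureReal_nonneg

theorem atomWeight_le_one (μ : Measure ℝ) [IsProbabilityMeasure μ] {α : ℝ}
    (hα : α ∈ Ioo (0 : ℝ) 1) : atomWeight μ α ≤ 1 :=
  div_le_one_of_le₀ (by linarith [le_measureReal_Ioi_add_atom μ hα]) measureReal_nonneg

theorem measureReal_Ioi_add_atomWeight_mul (μ : Measure ℝ) [IsProbabilityMeasure μ] {α : ℝ}
    (hα : α ∈ Ioo (0 : ℝ) 1) :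
    μ.real (Ioi (quantile μ α)) + atomWeight μ α * μ.real {quantile μ α} = 1 - α := by
  have h1 := measureReal_Ioi_quantile_le μ hα
  have h2 := le_measureReal_Ioi_add_atom μ hα
  by_cases h : μ.real {quantile μ α} = 0
  · rw [h] at h2 ⊢
    linarith
  · rw [atomWeight, div_mul_cancel₀ _ h]
    ring

theorem measurable_atomWeight (μ : Measure ℝ) [IsProbabilityMeasure μ] :
    Measurable (atomWeight μ) := by
  have hq := measurable_quantile μ
  have h1 : Measurable fun α => μ (Ioi (quantile μ α)) :=
    measurable_measure_prodMk_left (s := {p : ℝ × ℝ | quantile μ p.1 < p.2})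
      (measurableSet_lt (hq.comp measurable_fst) measurable_snd)
  have h2 : Measurable fun α => μ {quantile μ α} := by
    have := measurable_measure_prodMk_left (ν := μ) (s := {p : ℝ × ℝ | p.2 = quantile μ p.1})
      (measurableSet_eq_fun measurable_snd (hq.comp measurable_fst))
    exact this
  exact ((measurable_const.sub measurable_id).sub h1.ennreal_toReal).div h2.ennreal_toReal

/-- The densities attaining the conditional values at risk of a law `μ`, as functions of the level
`α` and the outcome `x`. For `α` outside `(0, 1)` the density is `1`; this covers the level `0`,
at which the quantile may be `-∞`. -/
noncomputable def tailDensity (μ : Measure ℝ) (α x : ℝ) : ℝ :=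
  if α ∈ Ioo (0 : ℝ) 1 then
    (1 / (1 - α)) * ((Ioi (quantile μ α)).indicator (fun _ => 1) x +
      atomWeight μ α * ({quantile μ α} : Set ℝ).indicator (fun _ => 1) x)
  else 1

theorem measurable_tailDensity (μ : Measure ℝ) [IsProbabilityMeasure μ] :
    Measurable (Function.uncurry (tailDensity μ)) := by
  have hq := measurable_quantile μ
  have h1 : Measurable fun p : ℝ × ℝ =>
      (Ioi (quantile μ p.1)).indicator (fun _ => (1 : ℝ)) p.2 :=
    (measurable_const (a := (1 : ℝ))).indicator
      (measurableSet_lt (hq.comp measurable_fst) measurable_snd)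
  have h2 : Measurable fun p : ℝ × ℝ =>
      ({quantile μ p.1} : Set ℝ).indicator (fun _ => (1 : ℝ)) p.2 :=
    (measurable_const (a := (1 : ℝ))).indicator
      (measurableSet_eq_fun measurable_snd (hq.comp measurable_fst))
  have h3 : Measurable fun p : ℝ × ℝ => atomWeight μ p.1 :=
    (measurable_atomWeight μ).comp measurable_fst
  exact Measurable.ite (measurable_fst measurableSet_Ioo)
    ((measurable_const.div (measurable_const.sub measurable_fst)).mul (h1.add (h3.mul h2)))
    measurable_const

theorem tailDensity_bounds (μ : Measure ℝ) [IsProbabilityMeasure μ] {α : ℝ}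
    (hα : α ∈ Ico (0 : ℝ) 1) (x : ℝ) :
    0 ≤ tailDensity μ α x ∧ tailDensity μ α x ≤ 1 / (1 - α) := by
  have hα' : 0 < 1 - α := sub_pos.2 hα.2
  rw [tailDensity]
  split_ifs with h
  · have h0 := atomWeight_nonneg μ h
    have h1 := atomWeight_le_one μ h
    have key : 0 ≤ (Ioi (quantile μ α)).indicator (fun _ => (1 : ℝ)) x +
        atomWeight μ α * ({quantile μ α} : Set ℝ).indicator (fun _ => 1) x ∧
        (Ioi (quantile μ α)).indicator (fun _ => (1 : ℝ)) x +
        atomWeight μ α * ({quantile μ α} : Set ℝ).indicator (fun _ => 1) x ≤ 1 := by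
      rcases lt_trichotomy (quantile μ α) x with hx | rfl | hx
      · simp [indicator, hx, hx.ne']
      · simp [h0, h1]
      · simp [indicator, hx.not_gt, hx.ne]
    exact ⟨mul_nonneg (by positivity) key.1, mul_le_of_le_one_right (by positivity) key.2⟩
  · exact ⟨zero_le_one, by rw [le_div_iff₀ hα']; linarith [hα.1]⟩

theorem integral_tailDensity (μ : Measure ℝ) [IsProbabilityMeasure μ] (α : ℝ) :
    ∫ x, tailDensity μ α x ∂μ = 1 := by
  simp only [tailDensity]
  split_ifs with h
  · have hα' : 1 - α ≠ 0 := (sub_pos.2 h.2).ne'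
    have i1 : Integrable ((Ioi (quantile μ α)).indicator fun _ => (1 : ℝ)) μ :=
      (integrable_const _).indicator measurableSet_Ioi
    have i2 : Integrable (({quantile μ α} : Set ℝ).indicator fun _ => (1 : ℝ)) μ :=
      (integrable_const _).indicator (measurableSet_singleton _)
    rw [integral_const_mul, integral_add i1 (i2.const_mul _), integral_const_mul,
      integral_indicator_const _ measurableSet_Ioi,
      integral_indicator_const _ (measurableSet_singleton _), smul_eq_mul, smul_eq_mul, mul_one,
      mul_one, measureReal_Ioi_add_atomWeight_mul μ h, one_div, inv_mul_cancel₀ hα']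
  · simp

/-- The tail densities attain the bound `mul_integral_mul_le_integral_quantile_tail`. -/
theorem mul_integral_mul_tailDensity (hX : Measurable X) (hi : Integrable X P)
    {α : ℝ} (hα : α ∈ Ioo (0 : ℝ) 1) :
    (1 - α) * ∫ ω, X ω * tailDensity (P.map X) α (X ω) ∂P =
      ∫ s in Ioo α 1, quantile (P.map X) s := by
  have := Measure.isProbabilityMeasure_map (μ := P) hX.aemeasurable
  have hα' : 1 - α ≠ 0 := (sub_pos.2 hα.2).ne'
  rw [integral_quantile_tail P hX hi hα]
  have hm : Measurable (tailDensity (P.map X) α) :=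
    (measurable_tailDensity (P.map X)).comp measurable_prodMk_left
  have h1 : ∫ ω, tailDensity (P.map X) α (X ω) ∂P = 1 := by
    rw [← integral_map hX.aemeasurable hm.aestronglyMeasurable]
    exact integral_tailDensity _ α
  have hQ : Integrable (fun ω => tailDensity (P.map X) α (X ω)) P := by
    by_contra h
    rw [integral_undef h] at h1
    exact zero_ne_one h1
  have hpos : Integrable (fun ω => max (X ω - quantile (P.map X) α) 0) P :=
    (hi.sub (integrable_const _)).pos_part
  have key : ∀ ω, X ω * tailDensity (P.map X) α (X ω) =
      (1 - α)⁻¹ * max (X ω - quantile (P.map X) α) 0 +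
        quantile (P.map X) α * tailDensity (P.map X) α (X ω) := by
    intro ω
    rw [tailDensity, if_pos hα]
    rcases lt_trichotomy (quantile (P.map X) α) (X ω) with hx | hx | hx
    · rw [max_eq_left (sub_pos.2 hx).le]
      simp [indicator, hx, hx.ne']
      ring
    · simp [← hx]
    · rw [max_eq_right (sub_neg.2 hx).le]
      simp [indicator, hx.not_gt, hx.ne]
  simp_rw [key]
  rw [integral_add (hpos.const_mul _) (hQ.const_mul _), integral_const_mul, integral_const_mul, h1]
  field_simp
  ring

/-! ### Mixing over the levels -/

/-- The integrand `n (n - 1) α ^ (n - 2) q(s)` on the triangle `α < s`, whose integral over `s`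
and then `α` mixes the tail integrals of `q`. -/
theorem integrable_tail_kernel (n : ℕ) {q : ℝ → ℝ} (hq : IntegrableOn q (Ioo 0 1)) :
    Integrable (Function.uncurry fun α s : ℝ =>
      ((n : ℝ) * ((n : ℝ) - 1) * α ^ (n - 2)) * (Ioi α).indicator q s)
      (uniform01.prod uniform01) := by
  have hα : Integrable (fun α : ℝ => (n : ℝ) * ((n : ℝ) - 1) * α ^ (n - 2)) uniform01 :=
    (Continuous.integrableOn_Icc (by fun_prop)).mono_set Ioo_subset_Icc_self
  have h := (hα.mul_prod hq).indicator (s := {p : ℝ × ℝ | p.1 < p.2})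
    (measurableSet_lt measurable_fst measurable_snd)
  refine h.congr (.of_forall fun p => ?_)
  by_cases hp : p.1 < p.2 <;> simp [Function.uncurry, indicator, hp]

theorem setIntegral_Ioo_indicator_Ioi {q : ℝ → ℝ} {α : ℝ} (hα : α ∈ Ioo (0 : ℝ) 1) :
    ∫ s in Ioo (0 : ℝ) 1, (Ioi α).indicator q s = ∫ s in Ioo α 1, q s := by
  rw [setIntegral_indicator measurableSet_Ioi]
  congr 2
  ext s
  simp only [mem_inter_iff, mem_Ioo, mem_Ioi]
  exact ⟨fun h => ⟨h.2, h.1.2⟩, fun h => ⟨⟨hα.1.trans h.1, h.2⟩, h.1⟩⟩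

theorem integrableOn_weighted_tail (n : ℕ) {q : ℝ → ℝ} (hq : IntegrableOn q (Ioo 0 1)) :
    IntegrableOn (fun α : ℝ => ((n : ℝ) * ((n : ℝ) - 1) * α ^ (n - 2)) * ∫ s in Ioo α 1, q s)
      (Ioo 0 1) := by
  refine Integrable.congr (integrable_tail_kernel n hq).integral_prod_left ?_
  refine (ae_restrict_iff' measurableSet_Ioo).2 (.of_forall fun α hα => ?_)
  simp only [Function.uncurry]
  rw [integral_const_mul, setIntegral_Ioo_indicator_Ioi hα]

theorem integral_weighted_tail {n : ℕ} (hn : 2 ≤ n) {q : ℝ → ℝ} (hq : IntegrableOn q (Ioo 0 1)) :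
    ∫ α in Ioo (0 : ℝ) 1, ((n : ℝ) * ((n : ℝ) - 1) * α ^ (n - 2)) * ∫ s in Ioo α 1, q s =
      ∫ s in Ioo (0 : ℝ) 1, n * s ^ (n - 1) * q s := by
  have h := integral_integral_swap (integrable_tail_kernel n hq)
  refine Eq.trans (setIntegral_congr_fun measurableSet_Ioo fun α hα => ?_) (h.trans
    (setIntegral_congr_fun measurableSet_Ioo fun s hs => ?_))
  · rw [integral_const_mul, setIntegral_Ioo_indicator_Ioi hα]
  · have h1 : ∀ α : ℝ, ((n : ℝ) * ((n : ℝ) - 1) * α ^ (n - 2)) * (Ioi α).indicator q s =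
        (Iio s).indicator (fun α => ((n : ℝ) * ((n : ℝ) - 1) * α ^ (n - 2)) * q s) α := by
      intro α
      by_cases hp : α < s <;> simp [indicator, hp]
    have h2 : Ioo (0 : ℝ) 1 ∩ Iio s = Ioo 0 s := by
      ext α
      simp only [mem_inter_iff, mem_Ioo, mem_Iio]
      exact ⟨fun h => ⟨h.1.1, h.2⟩, fun h => ⟨⟨h.1, h.2.trans hs.2⟩, h.2⟩⟩
    simp only [h1]
    rw [setIntegral_indicator measurableSet_Iio, h2, integral_mul_const,
      ← integral_Ioc_eq_integral_Ioo, ← intervalIntegral.integral_of_le hs.1.le,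
      intervalIntegral.integral_const_mul, integral_pow]
    -- Writing `n = m + 2` removes the truncated subtractions in the exponents.
    obtain ⟨m, rfl⟩ := Nat.exists_eq_add_of_le' hn
    have hm : (m : ℝ) + 1 ≠ 0 := by positivity
    simp only [Nat.add_sub_cancel, show m + 2 - 1 = m + 1 from rfl]
    push_cast
    field_simp
    ring

/-- `MAXVAR_n` is a mixture of conditional values at risk; here `(1 - α) CVaR_α(X)` is written as
a tail integral of the quantile function. -/
theorem maxvar_eq_integral_tail {n : ℕ} (hn : 2 ≤ n) (hX : Measurable X) (hi : Integrable X P) :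
    maxvar P n X = ∫ α in Ioo (0 : ℝ) 1, ((n : ℝ) * ((n : ℝ) - 1) * α ^ (n - 2)) *
      ∫ s in Ioo α 1, quantile (P.map X) s := by
  rw [maxvar_eq_integral_quantile P (by omega) hX,
    integral_weighted_tail hn (integrableOn_quantile P hX hi)]

end Law

section Mixture

variable {P : Measure Ω} {X : Ω → ℝ}

/-- The constraints on the families `Q` in `maxvarMixtures`: joint measurability,
`0 ≤ Q_α ≤ 1 / (1 - α)` and `E(Q_α) = 1`. -/
structure IsDensityFamily (P : Measure Ω) (Q : ℝ → Ω → ℝ) : Prop where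
  measurable : Measurable (Function.uncurry Q)
  bounds : ∀ α ∈ Ico (0 : ℝ) 1, ∀ ω, 0 ≤ Q α ω ∧ Q α ω ≤ 1 / (1 - α)
  integral_eq_one : ∀ α ∈ Ico (0 : ℝ) 1, ∫ ω, Q α ω ∂P = 1

theorem mem_maxvarMixtures_iff {n : ℕ} {Y : Lp ℝ 2 P} :
    Y ∈ maxvarMixtures P n ↔ ∃ Q, IsDensityFamily P Q ∧
      ∀ᵐ ω ∂P, Y ω = ∫ α in Ioo (0 : ℝ) 1, Q α ω * maxvarWeight n α := by
  simp only [maxvarMixtures, mem_ofPred_eq, intervalIntegral.integral_of_le zero_le_one,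
    integral_Ioc_eq_integral_Ioo]
  constructor
  · rintro ⟨Q, h1, h2, h3⟩
    exact ⟨Q, ⟨h1, fun α hα => (h2 α hα).1, fun α hα => (h2 α hα).2⟩, h3⟩
  · rintro ⟨Q, h, h3⟩
    exact ⟨Q, h.measurable, fun α hα => ⟨h.bounds α hα, h.integral_eq_one α hα⟩, h3⟩

namespace IsDensityFamily

variable {Q Q' : ℝ → Ω → ℝ}

theorem abs_mul_weight_le (hQ : IsDensityFamily P Q) {n : ℕ} (hn : 2 ≤ n) {α : ℝ}
    (hα : α ∈ Ioo (0 : ℝ) 1) (ω : Ω) : |Q α ω * maxvarWeight n α| ≤ n * (n - 1) := by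
  obtain ⟨h0, h1⟩ := hQ.bounds α (Ioo_subset_Ico_self hα) ω
  have hα' : 0 < 1 - α := sub_pos.2 hα.2
  rw [le_div_iff₀ hα'] at h1
  have hn' : (1 : ℝ) ≤ n := by exact_mod_cast (by omega : 1 ≤ n)
  have hn1 : 0 ≤ (n : ℝ) * (n - 1) := mul_nonneg (by positivity) (sub_nonneg.2 hn')
  have hp0 : 0 ≤ α ^ (n - 2) := pow_nonneg hα.1.le _
  have hp1 : α ^ (n - 2) ≤ 1 := pow_le_one₀ hα.1.le hα.2.le
  have e : Q α ω * maxvarWeight n α = n * (n - 1) * (Q α ω * (1 - α) * α ^ (n - 2)) := by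
    rw [maxvarWeight]; ring
  rw [e, abs_of_nonneg (by positivity)]
  exact mul_le_of_le_one_right hn1 (mul_le_one₀ h1 hp0 hp1)

theorem measurable_mul_weight (hQ : IsDensityFamily P Q) (n : ℕ) :
    Measurable fun p : ℝ × Ω => Q p.1 p.2 * maxvarWeight n p.1 := by
  refine hQ.measurable.mul (Measurable.comp (g := maxvarWeight n) ?_ measurable_fst)
  unfold maxvarWeight
  fun_prop

theorem measurable_apply (hQ : IsDensityFamily P Q) (α : ℝ) : Measurable (Q α) :=
  hQ.measurable.comp measurable_prodMk_left

theorem integral_mul_weight_eq (n : ℕ) (α : ℝ) :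
    ∫ ω, X ω * (Q α ω * maxvarWeight n α) ∂P =
      ((n : ℝ) * ((n : ℝ) - 1) * α ^ (n - 2)) * ((1 - α) * ∫ ω, X ω * Q α ω ∂P) := by
  simp only [← mul_assoc]
  rw [integral_mul_const, maxvarWeight]
  ring

theorem integrable_mul_weight (hQ : IsDensityFamily P Q) {n : ℕ} (hn : 2 ≤ n) (ω : Ω) :
    Integrable (fun α => Q α ω * maxvarWeight n α) uniform01 :=
  Integrable.of_bound
    ((hQ.measurable_mul_weight n).comp measurable_prodMk_right).aestronglyMeasurable _
    ((ae_restrict_iff' measurableSet_Ioo).2 (.of_forall fun _ hα => hQ.abs_mul_weight_le hn hα ω))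

variable [IsProbabilityMeasure P]

/-- The mixture of a family of densities is a bounded random variable, hence lies in `L²`. -/
theorem memLp_mixture (hQ : IsDensityFamily P Q) {n : ℕ} (hn : 2 ≤ n) :
    MemLp (fun ω => ∫ α in Ioo (0 : ℝ) 1, Q α ω * maxvarWeight n α) 2 P := by
  refine MemLp.of_bound (C := n * (n - 1))
    (hQ.measurable_mul_weight n).stronglyMeasurable.integral_prod_left'.aestronglyMeasurable
    (.of_forall fun ω => ?_)
  have h := norm_integral_le_of_norm_le_const (μ := uniform01)
    (f := fun α => Q α ω * maxvarWeight n α) ((ae_restrict_iff' measurableSet_Ioo).2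
      (.of_forall fun _ hα => hQ.abs_mul_weight_le hn hα ω))
  simpa using h

theorem exists_mem_maxvarMixtures (hQ : IsDensityFamily P Q) {n : ℕ} (hn : 2 ≤ n) :
    ∃ Y ∈ maxvarMixtures P n,
      ∀ᵐ ω ∂P, Y ω = ∫ α in Ioo (0 : ℝ) 1, Q α ω * maxvarWeight n α :=
  ⟨(hQ.memLp_mixture hn).toLp, mem_maxvarMixtures_iff.2 ⟨Q, hQ, (hQ.memLp_mixture hn).coeFn_toLp⟩,
    (hQ.memLp_mixture hn).coeFn_toLp⟩

theorem integrable_apply (hQ : IsDensityFamily P Q) {α : ℝ} (hα : α ∈ Ico (0 : ℝ) 1) :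
    Integrable (Q α) P := by
  refine Integrable.of_bound (hQ.measurable_apply α).aestronglyMeasurable (1 / (1 - α))
    (.of_forall fun ω => ?_)
  rw [Real.norm_of_nonneg (hQ.bounds α hα ω).1]
  exact (hQ.bounds α hα ω).2

theorem convexComb (hQ : IsDensityFamily P Q) (hQ' : IsDensityFamily P Q') {a b : ℝ} (ha : 0 ≤ a)
    (hb : 0 ≤ b) (hab : a + b = 1) : IsDensityFamily P fun α ω => a * Q α ω + b * Q' α ω where
  measurable := (hQ.measurable.const_mul a).add (hQ'.measurable.const_mul b)
  bounds α hα ω := by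
    obtain ⟨h0, h1⟩ := hQ.bounds α hα ω
    obtain ⟨h0', h1'⟩ := hQ'.bounds α hα ω
    refine ⟨by positivity, ?_⟩
    calc a * Q α ω + b * Q' α ω ≤ a * (1 / (1 - α)) + b * (1 / (1 - α)) := by gcongr
      _ = 1 / (1 - α) := by rw [← add_mul, hab, one_mul]
  integral_eq_one α hα := by
    rw [integral_add ((hQ.integrable_apply hα).const_mul a) ((hQ'.integrable_apply hα).const_mul b),
      integral_const_mul, integral_const_mul, hQ.integral_eq_one α hα, hQ'.integral_eq_one α hα,
      mul_one, mul_one, hab]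

theorem integrable_mul_kernel (hQ : IsDensityFamily P Q) {n : ℕ} (hn : 2 ≤ n)
    (hi : Integrable X P) :
    Integrable (Function.uncurry fun α ω => X ω * (Q α ω * maxvarWeight n α))
      (uniform01.prod P) := by
  have hXi : Integrable (fun p : ℝ × Ω => X p.2) (uniform01.prod P) := hi.comp_snd uniform01
  refine hXi.mul_bdd (c := n * (n - 1)) (hQ.measurable_mul_weight n).aestronglyMeasurable ?_
  have h : ∀ᵐ p ∂uniform01.prod P, p.1 ∈ Ioo (0 : ℝ) 1 :=
    Measure.quasiMeasurePreserving_fst.ae (ae_restrict_mem measurableSet_Ioo)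
  filter_upwards [h] with p hp using hQ.abs_mul_weight_le hn hp p.2

theorem integral_mul_mixture (hQ : IsDensityFamily P Q) {n : ℕ} (hn : 2 ≤ n)
    (hi : Integrable X P) :
    ∫ ω, X ω * (∫ α in Ioo (0 : ℝ) 1, Q α ω * maxvarWeight n α) ∂P =
      ∫ α in Ioo (0 : ℝ) 1, ((n : ℝ) * ((n : ℝ) - 1) * α ^ (n - 2)) *
        ((1 - α) * ∫ ω, X ω * Q α ω ∂P) := by
  have h := integral_integral_swap (hQ.integrable_mul_kernel hn hi)
  simp only [integral_mul_weight_eq, integral_const_mul] at h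
  exact h.symm

theorem integrableOn_weighted_expectation (hQ : IsDensityFamily P Q) {n : ℕ} (hn : 2 ≤ n)
    (hi : Integrable X P) :
    IntegrableOn (fun α : ℝ => ((n : ℝ) * ((n : ℝ) - 1) * α ^ (n - 2)) *
      ((1 - α) * ∫ ω, X ω * Q α ω ∂P)) (Ioo 0 1) := by
  have h := (hQ.integrable_mul_kernel hn hi).integral_prod_left
  simp only [Function.uncurry, integral_mul_weight_eq] at h
  exact h

theorem integral_mul_mixture_le_maxvar (hQ : IsDensityFamily P Q) {n : ℕ} (hn : 2 ≤ n)
    (hX : Measurable X) (hi : Integrable X P) :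
    ∫ ω, X ω * (∫ α in Ioo (0 : ℝ) 1, Q α ω * maxvarWeight n α) ∂P ≤ maxvar P n X := by
  rw [hQ.integral_mul_mixture hn hi, maxvar_eq_integral_tail P hn hX hi]
  refine setIntegral_mono_on (hQ.integrableOn_weighted_expectation hn hi)
    (integrableOn_weighted_tail n (integrableOn_quantile P hX hi)) measurableSet_Ioo
    fun α hα => ?_
  have hα' := Ioo_subset_Ico_self hα
  have hn' : (1 : ℝ) ≤ n := by exact_mod_cast (by omega : 1 ≤ n)
  refine mul_le_mul_of_nonneg_left
    (mul_integral_mul_le_integral_quantile_tail P hX hi hα (hQ.measurable_apply α)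
      (hQ.bounds α hα') (hQ.integral_eq_one α hα')) ?_
  exact mul_nonneg (mul_nonneg (by positivity) (sub_nonneg.2 hn')) (pow_nonneg hα.1.le _)

end IsDensityFamily

variable [IsProbabilityMeasure P]

theorem isDensityFamily_tailDensity (hX : Measurable X) :
    IsDensityFamily P fun α ω => tailDensity (P.map X) α (X ω) := by
  have := Measure.isProbabilityMeasure_map (μ := P) hX.aemeasurable
  have hm := measurable_tailDensity (P.map X)
  refine ⟨hm.comp (measurable_fst.prodMk (hX.comp measurable_snd)),
    fun α hα ω => tailDensity_bounds _ hα _, fun α _ => ?_⟩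
  have hα : Measurable (tailDensity (P.map X) α) := hm.comp measurable_prodMk_left
  rw [← integral_map hX.aemeasurable hα.aestronglyMeasurable]
  exact integral_tailDensity _ α

theorem integral_mul_mixture_tailDensity {n : ℕ} (hn : 2 ≤ n) (hX : Measurable X)
    (hi : Integrable X P) :
    ∫ ω, X ω * (∫ α in Ioo (0 : ℝ) 1, tailDensity (P.map X) α (X ω) * maxvarWeight n α) ∂P =
      maxvar P n X := by
  rw [(isDensityFamily_tailDensity hX).integral_mul_mixture hn hi,
    maxvar_eq_integral_tail P hn hX hi]
  refine setIntegral_congr_fun measurableSet_Ioo fun α hα => ?_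
  rw [mul_integral_mul_tailDensity P hX hi hα]

end Mixture

/-! ### The set of mixtures and its support function -/

theorem inner_eq_integral_mul {P : Measure Ω} (X Y : Lp ℝ 2 P) :
    inner ℝ X Y = ∫ ω, X ω * Y ω ∂P := by
  rw [L2.inner_def]
  simp [mul_comm]

section SupportFunction

variable {P : Measure Ω} [IsProbabilityMeasure P]

theorem convex_maxvarMixtures {n : ℕ} (hn : 2 ≤ n) : Convex ℝ (maxvarMixtures P n) := by
  intro Y hY Y' hY' a b ha hb hab
  obtain ⟨Q, hQ, h⟩ := mem_maxvarMixtures_iff.1 hY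
  obtain ⟨Q', hQ', h'⟩ := mem_maxvarMixtures_iff.1 hY'
  refine mem_maxvarMixtures_iff.2 ⟨_, hQ.convexComb hQ' ha hb hab, ?_⟩
  filter_upwards [h, h', Lp.coeFn_add (a • Y) (b • Y'), Lp.coeFn_smul a Y, Lp.coeFn_smul b Y']
    with ω h1 h2 h3 h4 h5
  rw [h3, Pi.add_apply, h4, h5, Pi.smul_apply, Pi.smul_apply, h1, h2, smul_eq_mul, smul_eq_mul,
    ← integral_const_mul, ← integral_const_mul,
    ← integral_add ((hQ.integrable_mul_weight hn ω).const_mul a)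
      ((hQ'.integrable_mul_weight hn ω).const_mul b)]
  congr 1
  funext α
  ring

theorem integrable_coeFn_Lp_two (X : Lp ℝ 2 P) : Integrable X P :=
  (Lp.memLp X).integrable (by norm_num)

theorem integral_mul_le_maxvar {n : ℕ} (hn : 2 ≤ n) (X : Lp ℝ 2 P) {Y : Lp ℝ 2 P}
    (hY : Y ∈ closure (maxvarMixtures P n)) : ∫ ω, X ω * Y ω ∂P ≤ maxvar P n X := by
  have hcl : IsClosed {Y : Lp ℝ 2 P | inner ℝ X Y ≤ maxvar P n X} :=
    isClosed_le (continuous_const.inner continuous_id) continuous_const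
  rw [← inner_eq_integral_mul]
  refine closure_minimal (fun Z hZ => ?_) hcl hY
  obtain ⟨Q, hQ, h⟩ := mem_maxvarMixtures_iff.1 hZ
  rw [mem_ofPred_eq, inner_eq_integral_mul]
  refine le_of_eq_of_le (integral_congr_ae ?_) (hQ.integral_mul_mixture_le_maxvar hn
    (Lp.stronglyMeasurable X).measurable (integrable_coeFn_Lp_two X))
  filter_upwards [h] with ω hω
  rw [hω]

theorem exists_maxvarMixtures_integral_mul_eq {n : ℕ} (hn : 2 ≤ n) (X : Lp ℝ 2 P) :
    ∃ Y ∈ maxvarMixtures P n, ∫ ω, X ω * Y ω ∂P = maxvar P n X := by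
  have hX : Measurable X := (Lp.stronglyMeasurable X).measurable
  obtain ⟨Y, hY, h⟩ := (isDensityFamily_tailDensity (P := P) hX).exists_mem_maxvarMixtures hn
  refine ⟨Y, hY, Eq.trans (integral_congr_ae ?_)
    (integral_mul_mixture_tailDensity hn hX (integrable_coeFn_Lp_two X))⟩
  filter_upwards [h] with ω hω
  rw [hω]

theorem isRiskEnvelope_closure_maxvarMixtures {n : ℕ} (hn : 2 ≤ n) :
    IsRiskEnvelope P (fun X : Lp ℝ 2 P => maxvar P n X) (closure (maxvarMixtures P n)) where
  nonempty := by
    obtain ⟨Y, hY, -⟩ := exists_maxvarMixtures_integral_mul_eq hn (0 : Lp ℝ 2 P)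
    exact ⟨Y, subset_closure hY⟩
  convex := (convex_maxvarMixtures hn).closure
  isClosed := isClosed_closure
  isLUB X := by
    refine IsGreatest.isLUB ⟨?_, ?_⟩
    · obtain ⟨Y, hY, h⟩ := exists_maxvarMixtures_integral_mul_eq hn X
      exact ⟨Y, subset_closure hY, h⟩
    · rintro _ ⟨Y, hY, rfl⟩
      exact integral_mul_le_maxvar hn X hY

end SupportFunction

/-- A point of `A` outside `B` would be separated from `B` by some `Z ↦ E(X Z)`, and the two suprema
at this `X` would differ. -/
theorem IsRiskEnvelope.subset {P : Measure Ω} {R : Lp ℝ 2 P → ℝ} {A B : Set (Lp ℝ 2 P)}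
    (hA : IsRiskEnvelope P R A) (hB : IsRiskEnvelope P R B) : A ⊆ B := by
  intro Y hY
  by_contra hYB
  obtain ⟨f, u, hu, huY⟩ := geometric_hahn_banach_closed_point hB.convex hB.isClosed hYB
  -- By the Riesz representation theorem, the separating functional is `Z ↦ E(X Z)`.
  obtain ⟨X, rfl⟩ := (InnerProductSpace.toDual ℝ (Lp ℝ 2 P)).surjective f
  simp only [InnerProductSpace.toDual_apply_apply, inner_eq_integral_mul] at hu huY
  have h1 : ∫ ω, X ω * Y ω ∂P ≤ R X := (hA.isLUB X).1 ⟨Y, hY, rfl⟩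
  have h2 : R X ≤ u := (hB.isLUB X).2 (by
    rintro _ ⟨Z, hZ, rfl⟩
    exact (hu Z hZ).le)
  linarith

theorem IsRiskEnvelope.unique {P : Measure Ω} {R : Lp ℝ 2 P → ℝ} {A B : Set (Lp ℝ 2 P)}
    (hA : IsRiskEnvelope P R A) (hB : IsRiskEnvelope P R B) : A = B :=
  (hA.subset hB).antisymm (hB.subset hA)

end SampleSpace

theorem theorem4 {Ω : Type*} [MeasurableSpace Ω] (P : Measure Ω) [IsProbabilityMeasure P]
    (n : ℕ) (hn : 2 ≤ n) :
    IsRiskEnvelope P (fun X : Lp ℝ 2 P => maxvar P n X) (closure (maxvarMixtures P n)) ∧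
      ∀ 𝒬 : Set (Lp ℝ 2 P), IsRiskEnvelope P (fun X : Lp ℝ 2 P => maxvar P n X) 𝒬 →
        𝒬 = closure (maxvarMixtures P n) :=
  ⟨isRiskEnvelope_closure_maxvarMixtures hn,
    fun _ h => h.unique (isRiskEnvelope_closure_maxvarMixtures hn)⟩
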